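/- **Setting.** There are $n$ workers and a server. For $x\in\mathbb R^d$ let $\operatorname{supp}(x)=\{j : x_j\neq 0\}$, and let $\|\cdot\|$ be the Euclidean norm. *Functions.* $\mathcal F_{\delta,L}$ is the set of differentiable functions $f:\mathbb R^d\to\mathbb R$ (for some $d$) with $\|\nabla f(x)-\nabla f(y)\|\le L\|x-y\|$ for all $x,y$, bounded from below, and with $f(0)-\inf f\le\delta$. Let $\mathcal F=\bigcup_{\delta,L}\mathcal F_{\delta,L}$. *Compressors.* For $\omega\ge 0$, $\mathbb U(\omega)$ is the set of stochastic mappings $\mathcal C:\mathbb R^d\to\mathbb R^d$ with $\mathbb E[\mathcal C(x)]=x$ and $\mathbb E\|\mathcal C(x)-x\|^2\le\omega\|x\|^2$ for all $x\in\mathbb R^d$. *Protocol.* An algorithm $A$ consists, in every dimension $d$, of (deterministic) mappings $B_1^k, B_{2,i}^k:(\mathbb R^d)^{n\times k}\to\mathbb R^d$ and $L_i^k:(\mathbb R^d)^{k+1}\to\mathbb R^d$ ($k\ge 0$, $1\le i\le n$), where $L_i^k$ also has access to the gradient oracle of $f_i$. Given local functions $f_1,\dots,f_n\in\mathcal F$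 on $\mathbb R^d$ and compressors $\mathcal C_1,\dots,\mathcal C_n$, the protocol performs for $k=0,1,2,\dots$ $$x^k=B_1^k\big((g_i^j)_{i\le n,\,1\le j\le k}\big),\qquad s_i^k=B_{2,i}^k\big((g_{i'}^j)_{i'\le n,\,1\le j\le k}\big),\qquad \bar s_i^k=\mathcal C_i(s_i^k),\qquad g_i^{k+1}=L_i^k(\bar s_i^0,\dots,\bar s_i^k),$$ where each $\mathcal C_i$ is sampled afresh in every iteration, independently across iterations. *Zero-respecting algorithms.* $A$ is zero-respecting if for all $k\ge0$ and all $i$, and for all arguments of the mappings, $\operatorname{supp}(x^k)$ and $\operatorname{supp}(s_i^k)$ are contained in $\bigcup_{j=1}^k\bigcup_{i'=1}^n\operatorname{supp}(g_{i'}^j)$ (so $x^0=s_i^0=0$), and, for all $f_i\in\mathcal F$, there is a sequence of oracle queries $\hat g_1,\hat g_2,\dots\in\mathbb R^d$ such that $$\operatorname{supp}(\hat g_m)\subseteq\bigcup_{j=0}^k\operatorname{supp}(\bar s_i^j)\cup\bigcup_{l<m}\operatorname{supp}\big(\nabla f_i(\hat g_l)\big)\ \text{ for all } m\ge 1,\qquad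 \operatorname{supp}(g_i^{k+1})\subseteq\bigcup_{m\ge1}\operatorname{supp}(\hat g_m).$$ **Theorem.** There are universal constants $\bar c,\hat c>0$ such that the following holds. Let $n\ge2$ be an integer, $\omega\ge0$, and $L,\delta^0,\varepsilon>0$ with $\bar c\,\varepsilon<L\delta^0$. Then for every zero-respecting algorithm $A$ there exist a dimension $d$, a function $f\in\mathcal F_{\delta^0,L}$ on $\mathbb R^d$, functions $f_1,\dots,f_n\in\mathcal F$ with $f=\frac1n\sum_{i=1}^n f_i$, and i.i.d. compressors $\mathcal C_1,\dots,\mathcal C_n\in\mathbb U(\omega)$ such that the points $x^k$ of the protocol satisfy $$\mathbb E\big[\|\nabla f(x^k)\|^2\big]>\varepsilon\qquad\text{for all integers } 0\le k\le\hat c\,\frac{(\omega+1)L\delta^0}{\varepsilon}.$$ -/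

import Mathlib

open MeasureTheory ProbabilityTheory

noncomputable section

/-- The parameter space `ℝ^d` with its Euclidean norm. -/
abbrev Vec (d : ℕ) : Type := EuclideanSpace ℝ (Fin d)

/-- The support of a vector: the set of its non-zero coordinates. -/
def vecSupp {d : ℕ} (x : Vec d) : Set (Fin d) := {j | x j ≠ 0}

/-- The class `F_{δ, L}`: differentiable functions with `L`-Lipschitz gradient, bounded below,
and with `f(0) - inf f ≤ δ`. -/
def FunClass {d : ℕ} (δ L : ℝ) (f : Vec d → ℝ) : Prop :=
  Differentiable ℝ f ∧
  (∀ x y, ‖gradient f x - gradient f y‖ ≤ L * ‖x - y‖) ∧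
  BddBelow (Set.range f) ∧
  f 0 - ⨅ x, f x ≤ δ

/-- The class of admissible local functions: all functions that lie in `F_{δ, L}`
for some `δ` and `L`. -/
def IsAdmissible {d : ℕ} (f : Vec d → ℝ) : Prop := ∃ δ L : ℝ, FunClass δ L f

/-- The mappings of a distributed algorithm with `n` workers in dimension `d`.
Histories of the vectors sent by the workers are indexed so that `g i j` is the vector
`g_i^{j+1}`, for `j < k`. The worker map `work k i` receives the gradient oracle of the
local function `f_i` and the messages number `0, …, k` that worker `i` has received. -/
structure DistAlgorithm (n d : ℕ) where
  /-- `B_1^k`: the server's `k`-th point. -/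
  point : (k : ℕ) → (Fin n → Fin k → Vec d) → Vec d
  /-- `B_{2,i}^k`: the vector which the server compresses and sends to worker `i`. -/
  msg : (k : ℕ) → Fin n → (Fin n → Fin k → Vec d) → Vec d
  /-- `L_i^k`: the answer of worker `i`. -/
  work : (k : ℕ) → Fin n → (Vec d → Vec d) → (Fin (k + 1) → Vec d) → Vec d

/-- `q 0, q 1, …` is a sequence of oracle queries that starts from the coordinates in `S`:
each query is supported on `S` and on the supports of the answers to the earlier queries. -/
def IsQuerySequence {d : ℕ} (oracle : Vec d → Vec d) (S : Set (Fin d)) (q : ℕ → Vec d) : Prop :=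
  ∀ m : ℕ, vecSupp (q m) ⊆ S ∪ ⋃ l : Fin m, vecSupp (oracle (q l))

/-- Zero-respecting algorithms. -/
def DistAlgorithm.IsZeroRespecting {n d : ℕ} (A : DistAlgorithm n d) : Prop :=
  (∀ (k : ℕ) (g : Fin n → Fin k → Vec d),
    vecSupp (A.point k g) ⊆ ⋃ i : Fin n, ⋃ j : Fin k, vecSupp (g i j)) ∧
  (∀ (k : ℕ) (i : Fin n) (g : Fin n → Fin k → Vec d),
    vecSupp (A.msg k i g) ⊆ ⋃ i' : Fin n, ⋃ j : Fin k, vecSupp (g i' j)) ∧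
  (∀ (k : ℕ) (i : Fin n) (f : Vec d → ℝ), IsAdmissible f → ∀ s : Fin (k + 1) → Vec d,
    ∃ q : ℕ → Vec d,
      IsQuerySequence (gradient f) (⋃ j : Fin (k + 1), vecSupp (s j)) q ∧
      vecSupp (A.work k i (gradient f) s) ⊆ ⋃ m : ℕ, vecSupp (q m))

/-- The compressed vector `C_i^k(s_i^k)` received by worker `i` in iteration `k`, when the
workers hold the functions `f i` and `C k i` is the realization of the compressor of worker `i`
in iteration `k`. Here `s_i^k = B_{2,i}^k(g_1^1, …, g_n^k)`, and `g_i^{j+1}` is the answer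
of worker `i` to the compressed vectors number `0, …, j`. -/
def received {n d : ℕ} (A : DistAlgorithm n d) (f : Fin n → Vec d → ℝ)
    (C : ℕ → Fin n → Vec d → Vec d) (k : ℕ) (i : Fin n) : Vec d :=
  C k i (A.msg k i (fun (i' : Fin n) (j : Fin k) =>
    A.work j i' (gradient (f i')) (fun l : Fin (j + 1) => received A f C l i')))
termination_by k
decreasing_by
  have h1 := l.isLt
  have h2 := j.isLt
  omega

/-- The vector `g_i^{k+1}` which worker `i` sends to the server in iteration `k`. -/
def reply {n d : ℕ} (A : DistAlgorithm n d) (f : Fin n → Vec d → ℝ)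
    (C : ℕ → Fin n → Vec d → Vec d) (k : ℕ) (i : Fin n) : Vec d :=
  A.work k i (gradient (f i)) (fun l : Fin (k + 1) => received A f C l i)

/-- The point `x^k = B_1^k(g_1^1, …, g_n^k)` of the protocol. -/
def iterate {n d : ℕ} (A : DistAlgorithm n d) (f : Fin n → Vec d → ℝ)
    (C : ℕ → Fin n → Vec d → Vec d) (k : ℕ) : Vec d :=
  A.point k (fun (i : Fin n) (j : Fin k) => reply A f C j i)

/-- The class `U(om)` of unbiased compressors: a stochastic mapping `C` of `ℝ^d` with
`E[C(x)] = x` and `E‖C(x) - x‖² ≤ om ‖x‖²` for all `x`. -/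
def IsUnbiasedCompressor {Ω : Type*} [MeasurableSpace Ω] (μ : Measure Ω) {d : ℕ} (om : ℝ)
    (C : Ω → Vec d → Vec d) : Prop :=
  Measurable (Function.uncurry C) ∧
  ∀ x : Vec d,
    Integrable (fun w => C w x) μ ∧
    ∫ w, C w x ∂μ = x ∧
    Integrable (fun w => ‖C w x - x‖ ^ 2) μ ∧
    ∫ w, ‖C w x - x‖ ^ 2 ∂μ ≤ om * ‖x‖ ^ 2

end

/-!
The hard instance is a nonconvex chain `∑ₖ (penalty xₖ - gate xₖ₋₁ * ramp xₖ)`, scaled, with a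
virtual coordinate `x₋₁ = 1` in front. The gate, its derivative and the derivative of the penalty
vanish at `0`, so coordinate `k` of the gradient can be nonzero only if `xₖ` or `xₖ₋₁` is: the
coordinates have to be discovered one after the other. On the other hand all terms of a partial derivative have the same sign, and at the
first coordinate below `1` one of them is bounded away from zero. Hence the gradient is large as
long as the last coordinate is zero (`le_norm_chainGrad`). The Lipschitz constant of the gradient
does not depend on the length of the chain (`norm_chainGrad_sub_le`), and the initial gap is at
most linear in it (`neg_le_chain`), so a chain of length proportional to `L * δ / ε` is affordable.

The links of the chain are given alternately to two workers; the others hold the zero function.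
After a worker has discovered a coordinate, only the other worker can discover the next one, and
for this it must first receive the new coordinate from the server. The compressor is random
sparsification of the whole vector: with probability `1 / (om + 1)` it sends `(om + 1) • x`, and
otherwise `0`. Therefore each new coordinate costs a successful coin of one of the two workers
(`exists_progress`). By linearity of expectation, `k` iterations contain on average
`2 * k / (om + 1)` successful coins, so the squared gradient norm stays large in expectation while
`k` is at most a small multiple of `(om + 1)` times the length of the chain
(`le_integral_norm_gradient_sq`). This bound needs neither the independence of the coins nor a
concentration inequality. The mappings of the algorithm need not be measurable, but the first `k`
iterations depend on finitely many coins only, so every function of them is integrable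
(`integrable_of_finite_dependence`).
-/

namespace ChainLowerBound

/-! ### Scalar building blocks -/

/-- The gate `x₊² / (1 + x₊²)`, where `x₊ = max x 0`: it vanishes together with its derivative on
`x ≤ 0`, and is at least `1/2` on `x ≥ 1`. -/
noncomputable def gate (x : ℝ) : ℝ := max x 0 ^ 2 / (1 + max x 0 ^ 2)

/-- The derivative of `gate`. -/
noncomputable def gateDeriv (x : ℝ) : ℝ := 2 * max x 0 / (1 + max x 0 ^ 2) ^ 2

/-- A bounded, positive, strictly increasing function whose derivative is `1 / (1 + x ^ 2)`. -/
noncomputable def ramp (x : ℝ) : ℝ := Real.pi / 2 + Real.arctan x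

/-- The penalty `min x 0 ^ 2 / 2` on negative coordinates. -/
noncomputable def penalty (x : ℝ) : ℝ := max (-x) 0 ^ 2 / 2

lemma hasDerivAt_max_zero_sq (x : ℝ) :
    HasDerivAt (fun y : ℝ => max y 0 ^ 2) (2 * max x 0) x := by
  rcases lt_trichotomy x 0 with h | rfl | h
  · have : (fun y : ℝ => max y 0 ^ 2) =ᶠ[nhds x] fun _ => 0 := by
      filter_upwards [Iio_mem_nhds h] with y hy
      simp [max_eq_right (le_of_lt (Set.mem_Iio.1 hy))]
    rw [max_eq_right h.le, mul_zero]
    exact (hasDerivAt_const x (0 : ℝ)).congr_of_eventuallyEq this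
  · rw [hasDerivAt_iff_isLittleO]
    have h2 : (fun y : ℝ => (y - 0) ^ 2) =o[nhds 0] fun y => y - 0 := by
      simpa using Asymptotics.isLittleO_pow_id (𝕜 := ℝ) (n := 2) (by norm_num)
    refine Asymptotics.IsBigO.trans_isLittleO (Asymptotics.IsBigO.of_bound 1 ?_) h2
    refine Filter.Eventually.of_forall fun y => ?_
    rcases le_total y 0 with hy | hy <;> simp [hy, sq_nonneg]
  · have : (fun y : ℝ => max y 0 ^ 2) =ᶠ[nhds x] fun y => y ^ 2 := by
      filter_upwards [Ioi_mem_nhds h] with y hy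
      simp [max_eq_left (le_of_lt (Set.mem_Ioi.1 hy))]
    rw [max_eq_left h.le]
    exact HasDerivAt.congr_of_eventuallyEq (by simpa using hasDerivAt_pow 2 x) this

lemma hasDerivAt_gate (x : ℝ) : HasDerivAt gate (gateDeriv x) x := by
  have h := hasDerivAt_max_zero_sq x
  have h1 : (1 : ℝ) + max x 0 ^ 2 ≠ 0 := by positivity
  refine HasDerivAt.congr_deriv (f := gate) (h.div (h.const_add 1) h1) ?_
  unfold gateDeriv
  congr 1
  ring

lemma hasDerivAt_ramp (x : ℝ) : HasDerivAt ramp (1 / (1 + x ^ 2)) x :=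
  (Real.hasDerivAt_arctan x).const_add _

lemma hasDerivAt_penalty (x : ℝ) : HasDerivAt penalty (-max (-x) 0) x := by
  have h := ((hasDerivAt_max_zero_sq (-x)).comp x (hasDerivAt_neg x)).div_const 2
  exact HasDerivAt.congr_deriv (f := penalty) h (by ring)

lemma gate_nonneg (x : ℝ) : 0 ≤ gate x := by unfold gate; positivity

lemma gate_le_one (x : ℝ) : gate x ≤ 1 := by
  unfold gate
  rw [div_le_one (by positivity)]
  linarith

lemma half_le_gate {x : ℝ} (hx : 1 ≤ x) : 1 / 2 ≤ gate x := by
  unfold gate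
  rw [max_eq_left (by linarith), div_le_div_iff₀ (by norm_num) (by positivity)]
  nlinarith

@[simp] lemma gate_zero : gate 0 = 0 := by simp [gate]

lemma gateDeriv_nonneg (x : ℝ) : 0 ≤ gateDeriv x := by unfold gateDeriv; positivity

@[simp] lemma gateDeriv_zero : gateDeriv 0 = 0 := by simp [gateDeriv]

lemma gateDeriv_le_one (x : ℝ) : gateDeriv x ≤ 1 := by
  unfold gateDeriv
  rw [div_le_one (by positivity)]
  nlinarith [sq_nonneg (max x 0 - 1), sq_nonneg (max x 0 ^ 2)]

lemma ramp_nonneg (x : ℝ) : 0 ≤ ramp x := by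
  unfold ramp; linarith [Real.neg_pi_div_two_lt_arctan x]

lemma ramp_le_four (x : ℝ) : ramp x ≤ 4 := by
  unfold ramp; linarith [Real.arctan_lt_pi_div_two x, Real.pi_lt_four]

lemma penalty_nonneg (x : ℝ) : 0 ≤ penalty x := by unfold penalty; positivity

@[simp] lemma penalty_zero : penalty 0 = 0 := by simp [penalty]

lemma abs_gate_sub_le (x y : ℝ) : |gate x - gate y| ≤ |x - y| := by
  have h := Convex.norm_image_sub_le_of_norm_hasDerivWithin_le (f := gate) (f' := gateDeriv)
    (C := 1) (s := Set.univ) (x := y) (y := x)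
    (fun z _ => (hasDerivAt_gate z).hasDerivWithinAt)
    (fun z _ => by
      rw [Real.norm_eq_abs, abs_of_nonneg (gateDeriv_nonneg z)]
      exact gateDeriv_le_one z) convex_univ (Set.mem_univ _) (Set.mem_univ _)
  simpa [Real.norm_eq_abs] using h

lemma abs_rampDeriv_le_one (x : ℝ) : |1 / (1 + x ^ 2)| ≤ 1 := by
  rw [abs_of_nonneg (by positivity), div_le_one (by positivity)]
  nlinarith [sq_nonneg x]

lemma abs_ramp_sub_le (x y : ℝ) : |ramp x - ramp y| ≤ |x - y| := by
  have h := Convex.norm_image_sub_le_of_norm_hasDerivWithin_le (f := ramp)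
    (f' := fun x => 1 / (1 + x ^ 2)) (C := 1) (s := Set.univ) (x := y) (y := x)
    (fun z _ => (hasDerivAt_ramp z).hasDerivWithinAt)
    (fun z _ => abs_rampDeriv_le_one z) convex_univ (Set.mem_univ _) (Set.mem_univ _)
  simpa [Real.norm_eq_abs] using h

lemma abs_rampDeriv_sub_le (x y : ℝ) : |1 / (1 + x ^ 2) - 1 / (1 + y ^ 2)| ≤ |x - y| := by
  have hx : 0 < 1 + x ^ 2 := by positivity
  have hy : 0 < 1 + y ^ 2 := by positivity
  have h : 1 / (1 + x ^ 2) - 1 / (1 + y ^ 2)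
      = (x - y) * (-(x + y) / ((1 + x ^ 2) * (1 + y ^ 2))) := by
    field_simp; ring
  rw [h, abs_mul]
  refine mul_le_of_le_one_right (abs_nonneg _) ?_
  rw [abs_div, abs_of_pos (mul_pos hx hy), div_le_one (mul_pos hx hy), abs_neg, abs_le]
  constructor <;> nlinarith [sq_nonneg (x + 1), sq_nonneg (y + 1), sq_nonneg (x - 1),
    sq_nonneg (y - 1), sq_nonneg (x * y)]

lemma abs_div_one_add_sq_sub_le (x y : ℝ) :
    |x / (1 + x ^ 2) - y / (1 + y ^ 2)| ≤ |x - y| := by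
  have hx : 0 < 1 + x ^ 2 := by positivity
  have hy : 0 < 1 + y ^ 2 := by positivity
  have h : x / (1 + x ^ 2) - y / (1 + y ^ 2)
      = (x - y) * ((1 - x * y) / ((1 + x ^ 2) * (1 + y ^ 2))) := by
    field_simp; ring
  rw [h, abs_mul]
  refine mul_le_of_le_one_right (abs_nonneg _) ?_
  rw [abs_div, abs_of_pos (mul_pos hx hy), div_le_one (mul_pos hx hy), abs_le]
  constructor <;> nlinarith [sq_nonneg (x + y), sq_nonneg (x - y), sq_nonneg (x * y)]

lemma abs_max_zero_sub_le (x y : ℝ) : |max x 0 - max y 0| ≤ |x - y| := by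
  simpa using abs_max_sub_max_le_max x 0 y 0

/-- The difference of two products is controlled by bounds on one factor of each kind. -/
lemma abs_mul_sub_mul_le {a b a' b' A B : ℝ} (ha : |a| ≤ A) (hb : |b'| ≤ B) :
    |a * b - a' * b'| ≤ A * |b - b'| + B * |a - a'| := by
  have h : a * b - a' * b' = a * (b - b') + b' * (a - a') := by ring
  rw [h]
  refine (abs_add_le _ _).trans ?_
  rw [abs_mul, abs_mul]
  gcongr

lemma abs_gateDeriv_sub_le (x y : ℝ) : |gateDeriv x - gateDeriv y| ≤ 4 * |x - y| := by
  have key : ∀ u v : ℝ, |2 * u / (1 + u ^ 2) ^ 2 - 2 * v / (1 + v ^ 2) ^ 2| ≤ 4 * |u - v| := by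
    intro u v
    have e : ∀ t : ℝ, 2 * t / (1 + t ^ 2) ^ 2 = 2 * (t / (1 + t ^ 2) * (1 / (1 + t ^ 2))) := by
      intro t
      have : 1 + t ^ 2 ≠ 0 := by positivity
      field_simp
    have hb : |u / (1 + u ^ 2)| ≤ 1 := by
      rw [abs_div, abs_of_pos (by positivity : (0 : ℝ) < 1 + u ^ 2), div_le_one (by positivity),
        abs_le]
      constructor <;> nlinarith [sq_nonneg (u + 1), sq_nonneg (u - 1)]
    rw [e, e, ← mul_sub, abs_mul, abs_two]
    have := abs_mul_sub_mul_le (b := 1 / (1 + u ^ 2)) (a' := v / (1 + v ^ 2)) hb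
      (abs_rampDeriv_le_one v)
    linarith [abs_rampDeriv_sub_le u v, abs_div_one_add_sq_sub_le u v]
  have := key (max x 0) (max y 0)
  unfold gateDeriv
  linarith [abs_max_zero_sub_le x y]

/-! ### The chain function and its gradient -/

variable {T : ℕ}

/-- The `k`-th coordinate of `x`, extended by zero beyond the dimension, as a linear functional. -/
noncomputable def coord (T k : ℕ) : Vec T →L[ℝ] ℝ :=
  if h : k < T then EuclideanSpace.proj ⟨k, h⟩ else 0

@[simp] lemma coord_val (x : Vec T) (i : Fin T) : coord T i x = x i := by simp [coord]

lemma coord_of_le {k : ℕ} (h : T ≤ k) (x : Vec T) : coord T k x = 0 := by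
  simp [coord, not_lt.2 h]

/-- The coordinate that precedes the `k`-th one; a virtual coordinate with the constant value `1`
precedes the first one. -/
noncomputable def prev (x : Vec T) : ℕ → ℝ
  | 0 => 1
  | k + 1 => coord T k x

/-- The linear part of `x ↦ prev x k`. -/
noncomputable def prevLin (T : ℕ) : ℕ → Vec T →L[ℝ] ℝ
  | 0 => 0
  | k + 1 => coord T k

lemma prev_succ (x : Vec T) (k : ℕ) : prev x (k + 1) = coord T k x := rfl

lemma prevLin_zero : prevLin T 0 = 0 := rfl

lemma prevLin_succ (k : ℕ) : prevLin T (k + 1) = coord T k := rfl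

/-- The chain function with link weights `w`. Link `k` couples coordinate `k` to the preceding
one; link `T` ends in the coordinate `T`, which is constantly zero. -/
noncomputable def chain (w : ℕ → ℝ) (x : Vec T) : ℝ :=
  ∑ k ∈ Finset.range (T + 1),
    w k * (penalty (coord T k x) - gate (prev x k) * ramp (coord T k x))

/-- The gradient of `chain w`. -/
noncomputable def chainGrad (w : ℕ → ℝ) (x : Vec T) : Vec T :=
  WithLp.toLp 2 fun i : Fin T =>
    w i * (-max (-x i) 0 - gate (prev x i) * (1 / (1 + x i ^ 2)))
      - w (i + 1) * (gateDeriv (x i) * ramp (coord T (i + 1) x))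

lemma chainGrad_apply (w : ℕ → ℝ) (x : Vec T) (i : Fin T) :
    chainGrad w x i = w i * (-max (-x i) 0 - gate (prev x i) * (1 / (1 + x i ^ 2)))
      - w (i + 1) * (gateDeriv (x i) * ramp (coord T (i + 1) x)) := rfl

lemma hasFDerivAt_prev (x : Vec T) (k : ℕ) :
    HasFDerivAt (fun y : Vec T => prev y k) (prevLin T k) x := by
  cases k with
  | zero => exact hasFDerivAt_const (1 : ℝ) x
  | succ k => exact (coord T k).hasFDerivAt

lemma hasGradientAt_chain (w : ℕ → ℝ) (x : Vec T) :
    HasGradientAt (chain w) (chainGrad w x) x := by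
  have hterm : ∀ k ∈ Finset.range (T + 1), HasFDerivAt
      (fun y : Vec T => w k * (penalty (coord T k y) - gate (prev y k) * ramp (coord T k y)))
      (w k • ((-max (-coord T k x) 0) • coord T k
        - (gate (prev x k) • ((1 / (1 + coord T k x ^ 2)) • coord T k)
          + ramp (coord T k x) • (gateDeriv (prev x k) • prevLin T k)))) x := by
    intro k _
    have hc : HasFDerivAt (fun y : Vec T => coord T k y) (coord T k) x := (coord T k).hasFDerivAt
    have h1 := (hasDerivAt_penalty (coord T k x)).comp_hasFDerivAt x hc
    have h2 := (hasDerivAt_ramp (coord T k x)).comp_hasFDerivAt x hc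
    have h3 := (hasDerivAt_gate (prev x k)).comp_hasFDerivAt x (hasFDerivAt_prev x k)
    exact (h1.sub (h3.mul h2)).const_mul (w k)
  rw [hasGradientAt_iff_hasFDerivAt]
  refine (HasFDerivAt.fun_sum hterm).congr_fderiv ?_
  ext v
  rw [InnerProductSpace.toDual_apply_apply, PiLp.inner_apply]
  simp only [sum_apply, smul_apply, sub_apply, smul_eq_mul, mul_sub,
    ← sub_sub, Finset.sum_sub_distrib]
  -- Shifting the index in the sum of the gate derivatives attributes each of them to the coordinate
  -- on which the gate depends; the terms at both ends vanish.
  rw [Finset.sum_range_succ, Finset.sum_range_succ (fun k => w k * (gate _ * _)),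
    Finset.sum_range_succ' (fun k => w k * (ramp _ * _))]
  simp only [prevLin_zero, prevLin_succ, prev_succ, coord_of_le le_rfl, zero_apply,
    mul_zero, add_zero]
  simp only [← Finset.sum_sub_distrib]
  rw [← Fin.sum_univ_eq_sum_range (fun k => _ - _ - _) T]
  refine Finset.sum_congr rfl fun i _ => ?_
  simp only [coord_val, chainGrad_apply, RCLike.inner_apply, conj_trivial]
  ring

/-- Every entry of the gradient is nonpositive, so that contributions of different links do not
cancel. -/
lemma chainGrad_le {w : ℕ → ℝ} (hw : ∀ k, 0 ≤ w k) (x : Vec T) (i : Fin T) :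
    chainGrad w x i ≤ w i * (-max (-x i) 0 - gate (prev x i) * (1 / (1 + x i ^ 2))) := by
  rw [chainGrad_apply]
  have := mul_nonneg (hw (i + 1)) (mul_nonneg (gateDeriv_nonneg (x i))
    (ramp_nonneg (coord T (i + 1) x)))
  linarith

lemma abs_prev_sub (x y : Vec T) (k : ℕ) : |prev x k - prev y k| = |prevLin T k (x - y)| := by
  cases k <;> simp [prev, prevLin]

lemma abs_chainGrad_sub_le {w : ℕ → ℝ} {W : ℝ} (hw : ∀ k, |w k| ≤ W) (x y : Vec T)
    (i : Fin T) : |chainGrad w x i - chainGrad w y i| ≤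
      18 * W * (|prevLin T i (x - y)| + |coord T i (x - y)| + |coord T (i + 1) (x - y)|) := by
  have hW : 0 ≤ W := (abs_nonneg _).trans (hw 0)
  set p := |prevLin T i (x - y)| with hp
  set c := |coord T i (x - y)| with hc
  set s := |coord T (i + 1) (x - y)| with hs
  have hc' : |x i - y i| = c := by simp [hc]
  have hs' : |coord T (i + 1) x - coord T (i + 1) y| = s := by simp [hs]
  have hp' : |prev x i - prev y i| = p := abs_prev_sub x y i
  have h1 : |-max (-x i) 0 - -max (-y i) 0| ≤ c := by
    have := abs_max_zero_sub_le (-x i) (-y i)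
    rw [neg_sub_neg, abs_sub_comm]
    refine this.trans (le_of_eq ?_)
    rw [neg_sub_neg, abs_sub_comm, hc']
  have h2 : |gate (prev x i) * (1 / (1 + x i ^ 2)) - gate (prev y i) * (1 / (1 + y i ^ 2))|
      ≤ c + p := by
    have := abs_mul_sub_mul_le (a := gate (prev x i)) (b := 1 / (1 + x i ^ 2))
      (a' := gate (prev y i)) (b' := 1 / (1 + y i ^ 2)) (A := 1)
      (by rw [abs_of_nonneg (gate_nonneg _)]; exact gate_le_one _) (abs_rampDeriv_le_one _)
    linarith [abs_gate_sub_le (prev x i) (prev y i), abs_rampDeriv_sub_le (x i) (y i)]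
  have h3 : |gateDeriv (x i) * ramp (coord T (i + 1) x)
      - gateDeriv (y i) * ramp (coord T (i + 1) y)| ≤ s + 16 * c := by
    have := abs_mul_sub_mul_le (a := gateDeriv (x i)) (b := ramp (coord T (i + 1) x))
      (a' := gateDeriv (y i)) (b' := ramp (coord T (i + 1) y)) (A := 1) (B := 4)
      (by rw [abs_of_nonneg (gateDeriv_nonneg _)]; exact gateDeriv_le_one _)
      (by rw [abs_of_nonneg (ramp_nonneg _)]; exact ramp_le_four _)
    linarith [abs_gateDeriv_sub_le (x i) (y i),
      abs_ramp_sub_le (coord T (i + 1) x) (coord T (i + 1) y)]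
  have e : chainGrad w x i - chainGrad w y i =
      w i * ((-max (-x i) 0 - -max (-y i) 0) -
        (gate (prev x i) * (1 / (1 + x i ^ 2)) - gate (prev y i) * (1 / (1 + y i ^ 2))))
      - w (i + 1) * (gateDeriv (x i) * ramp (coord T (i + 1) x)
        - gateDeriv (y i) * ramp (coord T (i + 1) y)) := by
    rw [chainGrad_apply, chainGrad_apply]; ring
  have h4 : |w i * ((-max (-x i) 0 - -max (-y i) 0) -
        (gate (prev x i) * (1 / (1 + x i ^ 2)) - gate (prev y i) * (1 / (1 + y i ^ 2))))|
      ≤ W * (c + (c + p)) := by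
    rw [abs_mul]
    exact mul_le_mul (hw _) ((abs_sub _ _).trans (add_le_add h1 h2)) (abs_nonneg _) hW
  have h5 : |w (i + 1) * (gateDeriv (x i) * ramp (coord T (i + 1) x)
        - gateDeriv (y i) * ramp (coord T (i + 1) y))| ≤ W * (s + 16 * c) := by
    rw [abs_mul]
    exact mul_le_mul (hw _) h3 (abs_nonneg _) hW
  rw [e]
  refine (abs_sub _ _).trans ((add_le_add h4 h5).trans ?_)
  have hp0 : 0 ≤ p := abs_nonneg _
  have hs0 : 0 ≤ s := abs_nonneg _
  nlinarith [mul_nonneg hW hp0, mul_nonneg hW hs0]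

lemma sum_coord_sq (x : Vec T) : ∑ i : Fin T, coord T i x ^ 2 = ‖x‖ ^ 2 := by
  simp [EuclideanSpace.norm_sq_eq]

lemma sum_prevLin_sq_le (x : Vec T) : ∑ i : Fin T, prevLin T i x ^ 2 ≤ ‖x‖ ^ 2 := by
  rw [← sum_coord_sq, Fin.sum_univ_eq_sum_range (fun k => prevLin T k x ^ 2) T,
    Fin.sum_univ_eq_sum_range (fun k => coord T k x ^ 2) T]
  have := Finset.sum_range_succ' (fun k => prevLin T k x ^ 2) T
  rw [Finset.sum_range_succ] at this
  simp only [prevLin_zero, prevLin_succ, zero_apply] at this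
  nlinarith [sq_nonneg (prevLin T T x)]

lemma sum_coord_succ_sq_le (x : Vec T) : ∑ i : Fin T, coord T (i + 1) x ^ 2 ≤ ‖x‖ ^ 2 := by
  rw [← sum_coord_sq, Fin.sum_univ_eq_sum_range (fun k => coord T (k + 1) x ^ 2) T,
    Fin.sum_univ_eq_sum_range (fun k => coord T k x ^ 2) T]
  have := Finset.sum_range_succ' (fun k => coord T k x ^ 2) T
  rw [Finset.sum_range_succ, coord_of_le le_rfl] at this
  nlinarith [sq_nonneg (coord T 0 x)]

lemma norm_chainGrad_sub_le {w : ℕ → ℝ} {W : ℝ} (hw : ∀ k, |w k| ≤ W) (x y : Vec T) :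
    ‖chainGrad w x - chainGrad w y‖ ≤ 54 * W * ‖x - y‖ := by
  have hW : 0 ≤ W := (abs_nonneg _).trans (hw 0)
  refine le_of_sq_le_sq ?_ (by positivity)
  rw [EuclideanSpace.norm_sq_eq]
  have hb : ∀ i : Fin T, ‖(chainGrad w x - chainGrad w y) i‖ ^ 2 ≤
      (18 * W) ^ 2 * (3 * (prevLin T i (x - y) ^ 2 + coord T i (x - y) ^ 2
        + coord T (i + 1) (x - y) ^ 2)) := by
    intro i
    have h := abs_chainGrad_sub_le hw x y i
    rw [PiLp.sub_apply, Real.norm_eq_abs]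
    refine (pow_le_pow_left₀ (abs_nonneg _) h 2).trans ?_
    rw [mul_pow]
    refine mul_le_mul_of_nonneg_left ?_ (sq_nonneg _)
    rw [← sq_abs (prevLin T i (x - y)), ← sq_abs (coord T i (x - y)),
      ← sq_abs (coord T (i + 1) (x - y))]
    generalize |prevLin T i (x - y)| = p
    generalize |coord T i (x - y)| = c
    generalize |coord T (i + 1) (x - y)| = s
    nlinarith [sq_nonneg (p - c), sq_nonneg (p - s), sq_nonneg (c - s)]
  refine (Finset.sum_le_sum fun i _ => hb i).trans ?_
  rw [← Finset.mul_sum, ← Finset.mul_sum, Finset.sum_add_distrib, Finset.sum_add_distrib]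
  have h1 := sum_prevLin_sq_le (x - y)
  have h2 := sum_coord_sq (x - y)
  have h3 := sum_coord_succ_sq_le (x - y)
  have e : (54 * W * ‖x - y‖) ^ 2 = (18 * W) ^ 2 * (3 * (‖x - y‖ ^ 2 + ‖x - y‖ ^ 2
      + ‖x - y‖ ^ 2)) := by ring
  rw [e]
  gcongr
  exact h2.le

lemma neg_le_chain {w : ℕ → ℝ} {W : ℝ} (hw0 : ∀ k, 0 ≤ w k) (hw : ∀ k, w k ≤ W) (x : Vec T) :
    -(4 * W * (T + 1)) ≤ chain w x := by
  have h : ∀ k ∈ Finset.range (T + 1), -(4 * W) ≤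
      w k * (penalty (coord T k x) - gate (prev x k) * ramp (coord T k x)) := by
    intro k _
    have h1 := penalty_nonneg (coord T k x)
    have h2 : gate (prev x k) * ramp (coord T k x) ≤ 1 * 4 :=
      mul_le_mul (gate_le_one _) (ramp_le_four _) (ramp_nonneg _) zero_le_one
    nlinarith [hw0 k, hw k]
  have := Finset.card_nsmul_le_sum _ _ _ h
  rw [Finset.card_range, nsmul_eq_mul] at this
  unfold chain
  push_cast at this
  linarith

lemma chain_zero_le {w : ℕ → ℝ} (hw0 : ∀ k, 0 ≤ w k) : chain w (0 : Vec T) ≤ 0 := by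
  refine Finset.sum_nonpos fun k _ => ?_
  have := mul_nonneg (hw0 k) (mul_nonneg (gate_nonneg (prev (0 : Vec T) k)) (ramp_nonneg 0))
  simp only [map_zero, penalty_zero, zero_sub]
  linarith

/-- If the last coordinate vanishes then the gradient is bounded away from zero: at the first
coordinate smaller than `1`, either the ramp of its link, whose gate is open, or the penalty has
a slope bounded away from zero. -/
lemma le_norm_chainGrad {a : ℝ} (ha : 0 ≤ a) (x : Vec (T + 1)) (hx : x (Fin.last T) = 0) :
    a / 4 ≤ ‖chainGrad (fun _ => a) x‖ := by
  classical
  have hex : ∃ k, coord (T + 1) k x < 1 := ⟨T + 1, by rw [coord_of_le le_rfl]; norm_num⟩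
  have hmin : Nat.find hex ≤ T := Nat.find_min' hex (by
    have := coord_val x (Fin.last T)
    rw [Fin.val_last] at this
    rw [this, hx]; norm_num)
  have hlt := Nat.find_spec hex
  have hprev : 1 ≤ prev x (Nat.find hex) := by
    rcases hk : Nat.find hex with _ | k
    · exact le_refl _
    · exact not_lt.1 (Nat.find_min hex (m := k) (by omega))
  let i : Fin (T + 1) := ⟨Nat.find hex, by omega⟩
  have hi : coord (T + 1) (Nat.find hex) x = x i := coord_val x i
  rw [hi] at hlt
  have h := chainGrad_le (w := fun _ => a) (fun _ => ha) x i
  have hg : 1 / 2 ≤ gate (prev x i) := half_le_gate hprev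
  have hkey : -max (-x i) 0 - gate (prev x i) * (1 / (1 + x i ^ 2)) ≤ -(1 / 4) := by
    have hpos : 0 ≤ 1 / (1 + x i ^ 2) := by positivity
    rcases le_or_gt (x i) (-1) with hn | hn
    · have : 1 ≤ max (-x i) 0 := le_max_of_le_left (by linarith)
      nlinarith [mul_nonneg (gate_nonneg (prev x i)) hpos]
    · have h0 : 0 ≤ max (-x i) 0 := le_max_right _ _
      have h1 : 1 / 2 ≤ 1 / (1 + x i ^ 2) := by
        apply one_div_le_one_div_of_le (by positivity)
        nlinarith
      nlinarith
  have habs : a / 4 ≤ |chainGrad (fun _ => a) x i| := by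
    rw [le_abs]; right
    nlinarith
  exact habs.trans (PiLp.norm_apply_le (chainGrad (fun _ => a) x) i)

/-! ### The scaled chain function -/

/-- The chain function precomposed with the dilation by `b`. -/
noncomputable def scaledChain (w : ℕ → ℝ) (b : ℝ) (x : Vec T) : ℝ := chain w (b • x)

lemma hasGradientAt_scaledChain (w : ℕ → ℝ) (b : ℝ) (x : Vec T) :
    HasGradientAt (scaledChain w b) (b • chainGrad w (b • x)) x := by
  have h := (hasGradientAt_chain w (b • x)).hasFDerivAt
  have hs : HasFDerivAt (fun y : Vec T => b • y) (b • ContinuousLinearMap.id ℝ (Vec T)) x :=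
    (hasFDerivAt_id x).const_smul b
  rw [hasGradientAt_iff_hasFDerivAt]
  refine (HasFDerivAt.comp x h hs).congr_fderiv ?_
  ext v
  simp

lemma gradient_scaledChain (w : ℕ → ℝ) (b : ℝ) (x : Vec T) :
    gradient (scaledChain w b) x = b • chainGrad w (b • x) :=
  (hasGradientAt_scaledChain w b x).gradient

lemma funClass_scaledChain {w : ℕ → ℝ} {W b δ L : ℝ} (hw0 : ∀ k, 0 ≤ w k) (hw : ∀ k, w k ≤ W)
    (hL : 54 * W * b ^ 2 ≤ L) (hδ : 4 * W * (T + 1) ≤ δ) :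
    FunClass δ L (scaledChain w b : Vec T → ℝ) := by
  have hbd : ∀ x : Vec T, -(4 * W * (T + 1)) ≤ scaledChain w b x :=
    fun x => neg_le_chain hw0 hw (b • x)
  refine ⟨fun x => (hasGradientAt_scaledChain w b x).differentiableAt, fun x y => ?_,
    ⟨-(4 * W * (T + 1)), ?_⟩, ?_⟩
  · rw [gradient_scaledChain, gradient_scaledChain, ← smul_sub, norm_smul]
    have h := norm_chainGrad_sub_le (w := w) (W := W)
      (fun k => by rw [abs_of_nonneg (hw0 k)]; exact hw k) (b • x) (b • y)
    rw [← smul_sub, norm_smul] at h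
    calc ‖b‖ * ‖chainGrad w (b • x) - chainGrad w (b • y)‖
        ≤ ‖b‖ * (54 * W * (‖b‖ * ‖x - y‖)) := by gcongr
      _ = 54 * W * b ^ 2 * ‖x - y‖ := by rw [Real.norm_eq_abs, ← sq_abs b]; ring
      _ ≤ L * ‖x - y‖ := by gcongr
  · rintro _ ⟨x, rfl⟩
    exact hbd x
  · have h0 : scaledChain w b (0 : Vec T) ≤ 0 := by
      simpa [scaledChain] using chain_zero_le (T := T) hw0
    have := le_ciInf hbd
    linarith

/-- The coordinates with index smaller than `m`. -/
def below (T m : ℕ) : Set (Fin T) := {j | (j : ℕ) < m}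

lemma below_mono {m m' : ℕ} (h : m ≤ m') : below T m ⊆ below T m' :=
  fun j hj => lt_of_lt_of_le (show (j : ℕ) < m from hj) h

@[simp] lemma vecSupp_zero : vecSupp (0 : Vec T) = ∅ := by simp [vecSupp]

/-- A function without the link `m` does not reveal new coordinates to those who know only the
first `m` ones. -/
lemma vecSupp_gradient_subset_below {w : ℕ → ℝ} {m : ℕ} (hm : w m = 0) (b : ℝ) {x : Vec T}
    (hx : vecSupp x ⊆ below T m) : vecSupp (gradient (scaledChain w b) x) ⊆ below T m := by
  have h0 : ∀ j : Fin T, m ≤ j → x j = 0 := fun j hj => by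
    by_contra h
    exact absurd (show (j : ℕ) < m from hx h) (not_lt.2 hj)
  intro j hj
  by_contra hlt
  have hmj : m ≤ j := not_lt.1 hlt
  refine hj ?_
  rw [gradient_scaledChain, PiLp.smul_apply, chainGrad_apply, PiLp.smul_apply, h0 j hmj]
  have hlink : w j * gate (prev (b • x) j) = 0 := by
    rcases eq_or_lt_of_le hmj with h | h
    · rw [← h, hm, zero_mul]
    · obtain ⟨k, hk⟩ : ∃ k, (j : ℕ) = k + 1 := ⟨j - 1, by omega⟩
      have hkT : k < T := by have := j.isLt; omega
      have hc : coord T k (b • x) = 0 := by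
        have := coord_val (b • x) ⟨k, hkT⟩
        rw [this, PiLp.smul_apply, h0 _ (show m ≤ k by omega), smul_zero]
      rw [hk, prev_succ, hc, gate_zero, mul_zero]
  simp only [smul_eq_mul, mul_zero, neg_zero, max_self, gateDeriv_zero]
  linear_combination (-b) * hlink

lemma le_norm_gradient_scaledChain {a b : ℝ} (ha : 0 ≤ a) (hb : 0 ≤ b) (x : Vec (T + 1))
    (hx : vecSupp x ⊆ below (T + 1) T) :
    a * b / 4 ≤ ‖gradient (scaledChain (fun _ => a) b) x‖ := by
  have h0 : x (Fin.last T) = 0 := by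
    by_contra h
    exact lt_irrefl T (show (Fin.last T : ℕ) < T from hx h)
  rw [gradient_scaledChain, norm_smul, Real.norm_eq_abs, abs_of_nonneg hb]
  have := le_norm_chainGrad ha (b • x) (by simp [h0])
  nlinarith

/-! ### Progress of the protocol -/

/-- Random sparsification: the vector is scaled by `om + 1` if the coin shows `true`, and dropped
otherwise. -/
noncomputable def coinCompress (om : ℝ) (c : Bool) (x : Vec T) : Vec T :=
  if c then (om + 1) • x else 0

lemma vecSupp_coinCompress_subset (om : ℝ) (c : Bool) (x : Vec T) :
    vecSupp (coinCompress om c x) ⊆ vecSupp x := by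
  intro j hj hx
  refine hj ?_
  unfold coinCompress
  split_ifs <;> simp [hx]

lemma IsQuerySequence.vecSupp_subset {oracle : Vec T → Vec T} {S U : Set (Fin T)}
    {q : ℕ → Vec T} (h : IsQuerySequence oracle S q) (hS : S ⊆ U)
    (hU : ∀ x, vecSupp x ⊆ U → vecSupp (oracle x) ⊆ U) (m : ℕ) : vecSupp (q m) ⊆ U := by
  induction m using Nat.strong_induction_on with
  | _ m ih =>
    exact (h m).trans (Set.union_subset hS (Set.iUnion_subset fun l => hU _ (ih l l.isLt)))

variable {n : ℕ}

lemma received_eq (A : DistAlgorithm n T) (f : Fin n → Vec T → ℝ)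
    (C : ℕ → Fin n → Vec T → Vec T) (k : ℕ) (i : Fin n) :
    received A f C k i =
      C k i (A.msg k i (fun (i' : Fin n) (j : Fin k) => reply A f C j i')) := by
  rw [received]; rfl

lemma vecSupp_reply_subset {A : DistAlgorithm n T} (hA : A.IsZeroRespecting)
    {f : Fin n → Vec T → ℝ} {C : ℕ → Fin n → Vec T → Vec T} {k : ℕ} {i : Fin n}
    (hf : IsAdmissible (f i)) {U : Set (Fin T)}
    (hU : ∀ x, vecSupp x ⊆ U → vecSupp (gradient (f i) x) ⊆ U)
    (hr : ∀ l ≤ k, vecSupp (received A f C l i) ⊆ U) : vecSupp (reply A f C k i) ⊆ U := by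
  obtain ⟨q, hq, hw⟩ := hA.2.2 k i (f i) hf (fun l : Fin (k + 1) => received A f C l i)
  refine hw.trans (Set.iUnion_subset fun m => IsQuerySequence.vecSupp_subset hq ?_ hU m)
  exact Set.iUnion_subset fun l => hr l (Nat.lt_succ_iff.1 l.isLt)

/-- The worker that holds link `m`: two workers alternate along the chain. -/
def owner (i₀ i₁ : Fin n) (m : ℕ) : Fin n := if Even m then i₀ else i₁

lemma owner_succ_ne {i₀ i₁ : Fin n} (h : i₀ ≠ i₁) (m : ℕ) :
    owner i₀ i₁ (m + 1) ≠ owner i₀ i₁ m := by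
  unfold owner
  by_cases hm : Even m
  · simp [hm, Nat.even_add_one, h.symm]
  · simp [hm, Nat.even_add_one, h]

/-- The number of coins of the workers `i₀` and `i₁` which show `true` before iteration `k`. -/
def passes (i₀ i₁ : Fin n) (c : ℕ × Fin n → Bool) (k : ℕ) : ℕ :=
  ∑ l ∈ Finset.range k, ((c (l, i₀)).toNat + (c (l, i₁)).toNat)

lemma toNat_owner_le (i₀ i₁ : Fin n) (c : ℕ × Fin n → Bool) (k m : ℕ) :
    (c (k, owner i₀ i₁ m)).toNat ≤ (c (k, i₀)).toNat + (c (k, i₁)).toNat := by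
  unfold owner
  split_ifs <;> omega

/-- The progress along the chain. After `k` iterations the workers have revealed at most the first
`m + 1` coordinates, where `m` is at most the number of coins that showed `true`; and the worker
that holds link `m + 1` has not yet received coordinate `m`, without which its gradient reveals
nothing new. Thus a further coordinate requires that the coin of this worker shows `true`. -/
lemma exists_progress {A : DistAlgorithm n T} (hA : A.IsZeroRespecting)
    {f : Fin n → Vec T → ℝ} (hf : ∀ i, IsAdmissible (f i)) {i₀ i₁ : Fin n} (hne : i₀ ≠ i₁)
    (hclosed : ∀ i m, owner i₀ i₁ m ≠ i → ∀ x, vecSupp x ⊆ below T m →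
      vecSupp (gradient (f i) x) ⊆ below T m)
    (om : ℝ) (c : ℕ × Fin n → Bool) (k : ℕ) :
    ∃ m, m ≤ passes i₀ i₁ c k ∧
      ∀ l < k, (∀ i, vecSupp (reply A f (fun k i => coinCompress om (c (k, i))) l i)
          ⊆ below T (m + 1)) ∧
        (∀ i, vecSupp (received A f (fun k i => coinCompress om (c (k, i))) l i)
          ⊆ below T (m + 1)) ∧
        vecSupp (received A f (fun k i => coinCompress om (c (k, i))) l (owner i₀ i₁ (m + 1)))
          ⊆ below T m := by
  set C : ℕ → Fin n → Vec T → Vec T := fun k i => coinCompress om (c (k, i)) with hC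
  induction k with
  | zero => exact ⟨0, Nat.zero_le _, fun l hl => absurd hl (Nat.not_lt_zero l)⟩
  | succ k ih =>
    obtain ⟨m, hm, h⟩ := ih
    have hpass : passes i₀ i₁ c (k + 1) = passes i₀ i₁ c k
        + ((c (k, i₀)).toNat + (c (k, i₁)).toNat) := Finset.sum_range_succ _ _
    have hle := toNat_owner_le i₀ i₁ c k (m + 1)
    have hrec : ∀ l ≤ k, ∀ i, vecSupp (received A f C l i) ⊆ below T (m + 1) := by
      intro l hl i
      rcases lt_or_eq_of_le hl with hl | rfl
      · exact (h l hl).2.1 i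
      · rw [received_eq]
        refine (vecSupp_coinCompress_subset _ _ _).trans ((hA.2.1 l i _).trans ?_)
        exact Set.iUnion_subset fun i' => Set.iUnion_subset fun j => (h j j.isLt).1 i'
    have hother : ∀ i, owner i₀ i₁ (m + 1) ≠ i → vecSupp (reply A f C k i) ⊆ below T (m + 1) :=
      fun i hi => vecSupp_reply_subset hA (hf i) (hclosed i _ hi) fun l hl => hrec l hl i
    by_cases hcoin : c (k, owner i₀ i₁ (m + 1)) = true
    · refine ⟨m + 1, ?_, fun l hl => ?_⟩
      · rw [hcoin, Bool.toNat_true] at hle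
        omega
      have hl' : l ≤ k := Nat.lt_succ_iff.1 hl
      have hmono : below T (m + 1) ⊆ below T (m + 1 + 1) := below_mono (Nat.le_succ _)
      refine ⟨fun i => ?_, fun i => (hrec l hl' i).trans hmono, hrec l hl' _⟩
      rcases lt_or_eq_of_le hl' with hlk | rfl
      · exact ((h l hlk).1 i).trans hmono
      by_cases hi : owner i₀ i₁ (m + 1) = i
      · refine vecSupp_reply_subset hA (hf i) (hclosed i _ ?_)
          fun l hl => (hrec l hl i).trans hmono
        rw [← hi]
        exact owner_succ_ne hne (m + 1)
      · exact (hother i hi).trans hmono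
    · have hmissed : ∀ l ≤ k, vecSupp (received A f C l (owner i₀ i₁ (m + 1))) ⊆ below T m := by
        intro l hl
        rcases lt_or_eq_of_le hl with hl | rfl
        · exact (h l hl).2.2
        · rw [received_eq]
          simp [hC, coinCompress, hcoin]
      refine ⟨m, by omega, fun l hl => ?_⟩
      have hl' : l ≤ k := Nat.lt_succ_iff.1 hl
      refine ⟨fun i => ?_, hrec l hl', hmissed l hl'⟩
      rcases lt_or_eq_of_le hl' with hlk | rfl
      · exact (h l hlk).1 i
      by_cases hi : owner i₀ i₁ (m + 1) = i
      · refine (vecSupp_reply_subset hA (hf i) (hclosed i m ?_) fun l hl => ?_).trans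
          (below_mono (Nat.le_succ m))
        · rw [← hi]
          exact (owner_succ_ne hne m).symm
        · rw [← hi]
          exact hmissed l hl
      · exact hother i hi

lemma vecSupp_iterate_subset {A : DistAlgorithm n T} (hA : A.IsZeroRespecting)
    {f : Fin n → Vec T → ℝ} (hf : ∀ i, IsAdmissible (f i)) {i₀ i₁ : Fin n} (hne : i₀ ≠ i₁)
    (hclosed : ∀ i m, owner i₀ i₁ m ≠ i → ∀ x, vecSupp x ⊆ below T m →
      vecSupp (gradient (f i) x) ⊆ below T m)
    (om : ℝ) (c : ℕ × Fin n → Bool) (k : ℕ) :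
    vecSupp (iterate A f (fun k i => coinCompress om (c (k, i))) k)
      ⊆ below T (passes i₀ i₁ c k + 1) := by
  obtain ⟨m, hm, h⟩ := exists_progress hA hf hne hclosed om c k
  refine (hA.1 k _).trans (Set.iUnion_subset fun i => Set.iUnion_subset fun j => ?_)
  exact ((h j j.isLt).1 i).trans (below_mono (by omega))

/-! ### Independent coins -/

/-- The law of independent coins, one for each iteration and each worker, which show `true` with
probability `p`. -/
noncomputable def coinMeasure (n : ℕ) (p : unitInterval) : Measure (ℕ × Fin n → Bool) :=
  Measure.infinitePi fun _ => bernoulliMeasure true false p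

instance (p : unitInterval) : IsProbabilityMeasure (coinMeasure n p) := by
  unfold coinMeasure; infer_instance

lemma measurePreserving_coin (p : unitInterval) (q : ℕ × Fin n) :
    MeasurePreserving (fun w : ℕ × Fin n → Bool => w q) (coinMeasure n p)
      (bernoulliMeasure true false p) :=
  measurePreserving_eval_infinitePi (fun _ : ℕ × Fin n => bernoulliMeasure true false p) q

lemma integrable_coin {E : Type*} [NormedAddCommGroup E] (p : unitInterval) (q : ℕ × Fin n)
    (g : Bool → E) : Integrable (fun w => g (w q)) (coinMeasure n p) :=
  (measurePreserving_coin p q).integrable_comp_of_integrable (Integrable.of_finite (f := g))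

lemma integral_coin {E : Type*} [NormedAddCommGroup E] [NormedSpace ℝ E] [CompleteSpace E]
    (p : unitInterval) (q : ℕ × Fin n) (g : Bool → E) :
    ∫ w, g (w q) ∂coinMeasure n p = (p : ℝ) • g true + (1 - p : ℝ) • g false := by
  have := Measure.isProbabilityMeasure_map (μ := coinMeasure n p)
    (measurePreserving_coin p q).measurable.aemeasurable
  have h := integral_map (μ := coinMeasure n p) (φ := fun w => w q) (f := g)
    (measurePreserving_coin p q).measurable.aemeasurable
    (Integrable.of_finite (μ := Measure.map (fun w => w q) (coinMeasure n p))).aestronglyMeasurable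
  rw [← h, (measurePreserving_coin p q).map_eq, bernoulliMeasure_def, integral_add_measure
    Integrable.of_finite Integrable.of_finite, integral_smul_nnreal_measure,
    integral_smul_nnreal_measure, integral_dirac, integral_dirac]
  rfl

lemma integrable_passes (p : unitInterval) (i₀ i₁ : Fin n) (k : ℕ) :
    Integrable (fun c => (passes i₀ i₁ c k : ℝ)) (coinMeasure n p) := by
  unfold passes
  push_cast
  exact integrable_finsetSum _ fun l _ =>
    (integrable_coin p (l, i₀) fun c => (c.toNat : ℝ)).add
      (integrable_coin p (l, i₁) fun c => (c.toNat : ℝ))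

lemma integral_passes (p : unitInterval) (i₀ i₁ : Fin n) (k : ℕ) :
    ∫ c, (passes i₀ i₁ c k : ℝ) ∂coinMeasure n p = 2 * k * p := by
  have hi : ∀ q : ℕ × Fin n, Integrable (fun c => ((c q).toNat : ℝ)) (coinMeasure n p) :=
    fun q => integrable_coin p q fun c => (c.toNat : ℝ)
  have hq : ∀ q : ℕ × Fin n, ∫ c, ((c q).toNat : ℝ) ∂coinMeasure n p = p := fun q => by
    simpa using integral_coin p q fun c => (c.toNat : ℝ)
  unfold passes
  push_cast
  rw [integral_finsetSum _ fun l _ => Integrable.fun_add (hi (l, i₀)) (hi (l, i₁))]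
  have : ∀ l, ∫ c, (((c (l, i₀)).toNat : ℝ) + ((c (l, i₁)).toNat : ℝ)) ∂coinMeasure n p
      = 2 * p := fun l => by
    rw [integral_add (hi (l, i₀)) (hi (l, i₁)), hq, hq]; ring
  simp only [this, Finset.sum_const, Finset.card_range, nsmul_eq_mul]
  ring

/-- A function of the coins of the first `k` iterations factors through a finite discrete space.
Hence it is integrable even if, like the mappings of an algorithm, it is built from functions that
are not assumed to be measurable. -/
lemma integrable_of_finite_dependence {E : Type*} [NormedAddCommGroup E] (p : unitInterval)
    (k : ℕ) {F : (ℕ × Fin n → Bool) → E}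
    (hF : ∀ c c', (∀ l < k, ∀ i, c (l, i) = c' (l, i)) → F c = F c') :
    Integrable F (coinMeasure n p) := by
  let φ : (ℕ × Fin n → Bool) → (Fin k × Fin n → Bool) := fun c q => c (q.1, q.2)
  let ψ : (Fin k × Fin n → Bool) → (ℕ × Fin n → Bool) :=
    fun c q => if h : q.1 < k then c (⟨q.1, h⟩, q.2) else false
  have hφ : Measurable φ := measurable_pi_lambda _ fun q => measurable_pi_apply _
  have : F = (F ∘ ψ) ∘ φ := by
    funext c
    exact hF _ _ fun l hl i => by simp [ψ, φ, hl]
  rw [this]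
  have := Measure.isProbabilityMeasure_map (μ := coinMeasure n p) hφ.aemeasurable
  exact Integrable.comp_measurable Integrable.of_finite hφ

lemma received_congr (A : DistAlgorithm n T) (f : Fin n → Vec T → ℝ)
    {C C' : ℕ → Fin n → Vec T → Vec T} (k : ℕ) (h : ∀ l ≤ k, C l = C' l) (i : Fin n) :
    received A f C k i = received A f C' k i := by
  induction k using Nat.strong_induction_on generalizing i with
  | _ k ih =>
    rw [received_eq, received_eq, h k le_rfl]
    congr 2
    funext i' j
    unfold reply
    congr 1
    funext l
    have hl : (l : ℕ) < k := lt_of_le_of_lt (Nat.lt_succ_iff.1 l.isLt) j.isLt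
    exact ih l hl (fun l' hl' => h l' (hl'.trans hl.le)) i'

lemma iterate_congr (A : DistAlgorithm n T) (f : Fin n → Vec T → ℝ)
    {C C' : ℕ → Fin n → Vec T → Vec T} (k : ℕ) (h : ∀ l < k, C l = C' l) :
    iterate A f C k = iterate A f C' k := by
  unfold iterate
  congr 1
  funext i j
  unfold reply
  congr 1
  funext l
  refine received_congr A f l (fun l' hl' => h l' ?_) i
  exact lt_of_le_of_lt (hl'.trans (Nat.lt_succ_iff.1 l.isLt)) j.isLt

lemma integrable_iterate (A : DistAlgorithm n T) (f : Fin n → Vec T → ℝ) (g : Vec T → ℝ)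
    (om : ℝ) (p : unitInterval) (k : ℕ) :
    Integrable (fun c : ℕ × Fin n → Bool =>
      g (iterate A f (fun k i => coinCompress om (c (k, i))) k)) (coinMeasure n p) := by
  refine integrable_of_finite_dependence p k fun c c' h => ?_
  rw [iterate_congr A f k fun l hl => funext fun i => by rw [h l hl i]]

/-! ### Random sparsification as a compressor -/

lemma isUnbiasedCompressor_coinCompress {om : ℝ} (hom : 0 ≤ om) {p : unitInterval}
    (hp : (p : ℝ) = 1 / (om + 1)) (q : ℕ × Fin n) :
    IsUnbiasedCompressor (d := T) (coinMeasure n p) om fun c => coinCompress om (c q) := by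
  have hom1 : om + 1 ≠ 0 := by positivity
  refine ⟨?_, fun x => ⟨integrable_coin p q fun c => coinCompress om c x, ?_,
    integrable_coin p q fun c => ‖coinCompress om c x - x‖ ^ 2, ?_⟩⟩
  · have hm : Measurable fun y : (ℕ × Fin n → Bool) × Vec T => y.1 q :=
      (measurable_pi_apply q).comp measurable_fst
    exact Measurable.ite (hm (measurableSet_singleton true)) (measurable_snd.fun_const_smul _)
      measurable_const
  · rw [integral_coin p q fun c => coinCompress om c x, hp]
    simp [coinCompress, smul_smul, hom1]
  · rw [integral_coin p q fun c => ‖coinCompress om c x - x‖ ^ 2, hp]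
    have h : (om + 1) • x - x = om • x := by module
    simp only [coinCompress, if_true, h, norm_smul, Bool.false_eq_true, if_false, zero_sub,
      norm_neg, smul_eq_mul, mul_pow, Real.norm_eq_abs, sq_abs]
    apply le_of_eq
    field_simp
    ring

lemma measurable_coinCompress (om : ℝ) :
    Measurable (coinCompress om : Bool → Vec T → Vec T) := Measurable.of_discrete

lemma iIndepFun_coinCompress (om : ℝ) (p : unitInterval) :
    iIndepFun (fun (q : ℕ × Fin n) (c : ℕ × Fin n → Bool) =>
      (coinCompress om (c q) : Vec T → Vec T)) (coinMeasure n p) :=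
  iIndepFun_infinitePi fun _ => measurable_coinCompress om

lemma identDistrib_coinCompress (om : ℝ) (p : unitInterval) (q q' : ℕ × Fin n) :
    IdentDistrib (fun c : ℕ × Fin n → Bool => (coinCompress om (c q) : Vec T → Vec T))
      (fun c => coinCompress om (c q')) (coinMeasure n p) (coinMeasure n p) :=
  IdentDistrib.comp (u := coinCompress om)
    ⟨(measurePreserving_coin p q).measurable.aemeasurable,
      (measurePreserving_coin p q').measurable.aemeasurable,
      by rw [(measurePreserving_coin p q).map_eq, (measurePreserving_coin p q').map_eq]⟩
    (measurable_coinCompress om)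

/-! ### The local functions and the lower bound -/

/-- The weights of the links that worker `i` holds. The factor `n` compensates the average over
the workers. -/
noncomputable def ownedWeight (i₀ i₁ : Fin n) (a : ℝ) (i : Fin n) (m : ℕ) : ℝ :=
  if owner i₀ i₁ m = i then n * a else 0

lemma ownedWeight_nonneg (i₀ i₁ : Fin n) {a : ℝ} (ha : 0 ≤ a) (i : Fin n) (m : ℕ) :
    0 ≤ ownedWeight i₀ i₁ a i m := by
  unfold ownedWeight; split_ifs <;> positivity

lemma ownedWeight_le (i₀ i₁ : Fin n) {a : ℝ} (ha : 0 ≤ a) (i : Fin n) (m : ℕ) :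
    ownedWeight i₀ i₁ a i m ≤ n * a := by
  unfold ownedWeight; split_ifs
  · exact le_rfl
  · positivity

lemma isAdmissible_ownedChain (i₀ i₁ : Fin n) {a : ℝ} (ha : 0 ≤ a) (b : ℝ) (i : Fin n) :
    IsAdmissible (scaledChain (ownedWeight i₀ i₁ a i) b : Vec T → ℝ) :=
  ⟨_, _, funClass_scaledChain (ownedWeight_nonneg i₀ i₁ ha i) (ownedWeight_le i₀ i₁ ha i)
    le_rfl le_rfl⟩

lemma scaledChain_eq_average (i₀ i₁ : Fin n) (hn : n ≠ 0) (a b : ℝ) (x : Vec T) :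
    scaledChain (fun _ => a) b x =
      1 / (n : ℝ) * ∑ i, scaledChain (ownedWeight i₀ i₁ a i) b x := by
  have hn' : (n : ℝ) ≠ 0 := Nat.cast_ne_zero.2 hn
  unfold scaledChain chain ownedWeight
  rw [Finset.sum_comm, Finset.mul_sum]
  refine Finset.sum_congr rfl fun k _ => ?_
  rw [← Finset.sum_mul, Finset.sum_ite_eq]
  simp only [Finset.mem_univ, if_true]
  field_simp

/-- The expected squared gradient norm decays at most linearly in the expected number of coins
that show `true`: as long as fewer than `T` coins have shown `true`, the last coordinate of the
iterate is zero. -/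
lemma le_integral_norm_gradient_sq {A : DistAlgorithm n (T + 1)} (hA : A.IsZeroRespecting)
    {i₀ i₁ : Fin n} (hne : i₀ ≠ i₁) {a b : ℝ} (ha : 0 ≤ a) (hb : 0 ≤ b) (hT : 0 < T) (om : ℝ)
    (p : unitInterval) (k : ℕ) :
    (a * b / 4) ^ 2 * (1 - 2 * k * p / T) ≤
      ∫ c, ‖gradient (scaledChain (fun _ => a) b) (iterate A
        (fun i => scaledChain (ownedWeight i₀ i₁ a i) b)
        (fun k i => coinCompress om (c (k, i))) k)‖ ^ 2 ∂coinMeasure n p := by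
  have hT' : (0 : ℝ) < T := Nat.cast_pos.2 hT
  have hpass := (integrable_passes p i₀ i₁ k).div_const (T : ℝ)
  have hint : ∫ c, (a * b / 4) ^ 2 * (1 - (passes i₀ i₁ c k : ℝ) / T) ∂coinMeasure n p
      = (a * b / 4) ^ 2 * (1 - 2 * k * p / T) := by
    rw [integral_const_mul, integral_sub (integrable_const 1) hpass, integral_div,
      integral_passes]
    simp
  rw [← hint]
  refine integral_mono (((integrable_const 1).sub hpass).const_mul _)
    (integrable_iterate A _ (fun x => ‖gradient (scaledChain (fun _ => a) b) x‖ ^ 2) om p k)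
    fun c => ?_
  -- Once `T` coins have shown `true`, the lower bound is nonpositive and thus trivial.
  dsimp only
  have hsq : 0 ≤ (a * b / 4) ^ 2 := sq_nonneg _
  rcases lt_or_ge (passes i₀ i₁ c k) T with hlt | hge
  · have hsupp := vecSupp_iterate_subset hA
      (fun i => isAdmissible_ownedChain i₀ i₁ ha b i) hne
      (fun i m hm x hx => vecSupp_gradient_subset_below (by simp [ownedWeight, hm]) b hx) om c k
    have h := le_norm_gradient_scaledChain ha hb _ (hsupp.trans (below_mono hlt))
    have h0 : 0 ≤ (passes i₀ i₁ c k : ℝ) / T := by positivity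
    calc (a * b / 4) ^ 2 * (1 - (passes i₀ i₁ c k : ℝ) / T) ≤ (a * b / 4) ^ 2 * 1 := by
          gcongr; linarith
      _ ≤ _ := by rw [mul_one]; gcongr
  · have h1 : 1 ≤ (passes i₀ i₁ c k : ℝ) / T := by
      rw [le_div_iff₀ hT', one_mul]
      exact_mod_cast hge
    exact (mul_nonpos_of_nonneg_of_nonpos hsq (by linarith)).trans (sq_nonneg _)

end ChainLowerBound

open ChainLowerBound in
theorem mainTheorem6 :
    ∃ cbar chat : ℝ, 0 < cbar ∧ 0 < chat ∧
      ∀ (n : ℕ) (om L δ ε : ℝ), 2 ≤ n → 0 ≤ om → 0 < L → 0 < δ → 0 < ε →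
        cbar * ε < L * δ →
        ∀ A : (d : ℕ) → DistAlgorithm n d, (∀ d : ℕ, (A d).IsZeroRespecting) →
          ∃ (d : ℕ) (f : Vec d → ℝ) (fs : Fin n → Vec d → ℝ),
            FunClass δ L f ∧
            (∀ i : Fin n, IsAdmissible (fs i)) ∧
            (∀ x : Vec d, f x = (1 / (n : ℝ)) * ∑ i : Fin n, fs i x) ∧
            ∃ (Ω : Type) (_ : MeasurableSpace Ω) (μ : Measure Ω)
              (C : ℕ → Fin n → Ω → Vec d → Vec d),
              IsProbabilityMeasure μ ∧
              (∀ (k : ℕ) (i : Fin n), IsUnbiasedCompressor μ om (C k i)) ∧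
              iIndepFun (fun (p : ℕ × Fin n) => C p.1 p.2) μ ∧
              (∀ p q : ℕ × Fin n, IdentDistrib (C p.1 p.2) (C q.1 q.2) μ μ) ∧
              ∀ k : ℕ, (k : ℝ) ≤ chat * ((om + 1) * L * δ / ε) →
                Integrable
                  (fun w => ‖gradient f (iterate (A d) fs (fun k' i => C k' i w) k)‖ ^ 2) μ ∧
                ε < ∫ w, ‖gradient f (iterate (A d) fs (fun k' i => C k' i w) k)‖ ^ 2 ∂μ := by
  refine ⟨100000, 1 / 100000, by norm_num, by norm_num, ?_⟩
  intro n om L δ ε hn hom hL hδ hε hbig A hA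
  let i₀ : Fin n := ⟨0, by omega⟩
  let i₁ : Fin n := ⟨1, by omega⟩
  have hne : i₀ ≠ i₁ := by simp [i₀, i₁]
  have hom1 : 0 < om + 1 := by positivity
  -- The scales solve `54 * a * b ^ 2 = L` and `(a * b / 4) ^ 2 = 4 * ε`; the length of the
  -- chain is the largest for which the bound `4 * a * (T + 2)` on the initial gap is at most `δ`.
  set s := Real.sqrt ε with hs
  have hs0 : 0 < s := Real.sqrt_pos.2 hε
  have hsq : s ^ 2 = ε := Real.sq_sqrt hε.le
  set a : ℝ := 3456 * ε / L with ha_def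
  set b : ℝ := L / (432 * s) with hb_def
  have ha : 0 < a := by positivity
  have hb : 0 < b := by positivity
  set R : ℝ := L * δ / ε with hR
  have hRbig : 100000 < R := by rwa [hR, lt_div_iff₀ hε]
  obtain ⟨T, hT⟩ : ∃ T : ℕ, ⌊R / 13824⌋₊ = T + 2 := by
    have : 2 ≤ ⌊R / 13824⌋₊ := Nat.le_floor (by push_cast; linarith)
    exact ⟨⌊R / 13824⌋₊ - 2, by omega⟩
  have hTle : (T : ℝ) + 2 ≤ R / 13824 := by
    have := Nat.floor_le (show 0 ≤ R / 13824 by linarith)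
    rw [hT] at this
    exact_mod_cast this
  have hTgt : R / 13824 < T + 3 := by
    have := Nat.lt_floor_add_one (R / 13824)
    rw [hT] at this
    push_cast at this
    linarith
  have hTpos : (0 : ℝ) < T := by linarith
  have hab : (a * b / 4) ^ 2 = 4 * ε := by
    have : a * b / 4 = 2 * s := by
      rw [ha_def, hb_def, ← hsq]; field_simp; norm_num
    rw [this, mul_pow, hsq]; norm_num
  have hf : FunClass δ L (scaledChain (fun _ => a) b : Vec (T + 1) → ℝ) := by
    refine funClass_scaledChain (fun _ => ha.le) (fun _ => le_rfl) (le_of_eq ?_) ?_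
    · rw [ha_def, hb_def, div_pow, mul_pow, hsq]; field_simp; norm_num
    · push_cast
      have h : 4 * a * ((T : ℝ) + 2) ≤ 4 * a * (R / 13824) := by gcongr
      have e : 4 * a * (R / 13824) = δ := by rw [ha_def, hR]; field_simp; norm_num
      linarith
  let p : unitInterval := ⟨1 / (om + 1), by positivity, by
    rw [div_le_one hom1]; linarith⟩
  have hp : (p : ℝ) = 1 / (om + 1) := rfl
  refine ⟨T + 1, scaledChain (fun _ => a) b, fun i => scaledChain (ownedWeight i₀ i₁ a i) b, hf,
    fun i => isAdmissible_ownedChain i₀ i₁ ha.le b i,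
    scaledChain_eq_average i₀ i₁ (by omega) a b,
    ℕ × Fin n → Bool, inferInstance, coinMeasure n p, fun k i c => coinCompress om (c (k, i)),
    inferInstance, fun k i => isUnbiasedCompressor_coinCompress hom hp (k, i),
    iIndepFun_coinCompress om p, identDistrib_coinCompress om p, fun k hk => ⟨?_, ?_⟩⟩
  · exact integrable_iterate (A (T + 1)) _
      (fun x => ‖gradient (scaledChain (fun _ => a) b) x‖ ^ 2) om p k
  · refine lt_of_lt_of_le ?_ (le_integral_norm_gradient_sq (hA (T + 1)) hne ha.le hb.le
      (Nat.cast_pos.1 hTpos) om p k)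
    have hkp : (k : ℝ) * p ≤ R / 100000 := by
      rw [hp, mul_one_div, div_le_iff₀ hom1]
      refine hk.trans (le_of_eq ?_)
      rw [hR]; ring
    have hfrac : 2 * (k : ℝ) * p / T < 3 / 4 := by
      rw [div_lt_iff₀ hTpos]
      linarith
    rw [hab]
    nlinarith
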